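/- Let $n\ge 4$ and let $T$ be an $n$-tournament, that is, a digraph with $n$ vertices $v_1,\dots,v_n$, without loops, in which every pair of distinct vertices is joined by exactly one arc. The skew-adjacency matrix of $T$ is the $n\times n$ real skew-symmetric matrix $S_T$ with zero diagonal whose $(i,j)$ entry, for $i\ne j$, is $1$ if there is an arc from $v_i$ to $v_j$ and $-1$ otherwise; let $\phi_T(x)$ be the characteristic polynomial of $S_T$. A real square matrix $Q$ is quasi-orthogonal if $Q^{\top}Q=qI$ for some real $q>0$. Let $\operatorname{ind}(T)$ be the least integer $d\ge 0$ such that $S_T$ is a principal submatrix of a real skew-symmetric quasi-orthogonal matrix of order $n+d$ (such a $d$ always exists). Then, for every integer $k\ge 0$: (i) if $n=4k+4$, then $\operatorname{ind}(T)\ge 0$, with equality if and only if $\phi_T(x)=(x^2+4k+3)^{2k+2}$; (ii) if $n=4k+3$, then $\operatorname{ind}(T)\ge 1$, with equality if and only if $\phi_T(x)=x(x^2+4k+3)^{2k+1}$; (iii) if $n=4k+2$, then $\operatorname{ind}(T)\ge 2$, with equality if and only if $\phi_T(x)=(x^2+4k+3)^{2k}(x^2+1)$; (iv) if $n=4k+1$,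 then $\operatorname{ind}(T)\ge 3$, with equality if and only if either $n=5$, or $n\ge 9$ and $\phi_T(x)=x(x^2+4k+3)^{2k-1}(x^2+3)$. -/

import Mathlib

/-- A square real matrix `Q` is quasi-orthogonal if `Qᵀ Q = q I` for some real `q > 0`. -/
def IsQuasiOrthogonal {m : Type*} [Fintype m] [DecidableEq m] (Q : Matrix m m ℝ) : Prop :=
  ∃ q : ℝ, 0 < q ∧ Q.transpose * Q = q • (1 : Matrix m m ℝ)

/-- `Q` is a quasi-orthogonal extension of `S`: a skew-symmetric quasi-orthogonal matrix having `S`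
as a principal submatrix (rows and columns selected by the same injection `f`). -/
def IsQuasiOrthogonalExtension {ι m : Type*} [Fintype m] [DecidableEq m]
    (Q : Matrix m m ℝ) (S : Matrix ι ι ℝ) : Prop :=
  Q.transpose = -Q ∧ IsQuasiOrthogonal Q ∧ ∃ f : ι ↪ m, Q.submatrix f f = S

/-- The numbers `d` such that `S`, of order `n`, has a quasi-orthogonal extension of
order `n + d`. -/
def quasiOrthogonalityDefects {ι : Type*} [Fintype ι] (S : Matrix ι ι ℝ) : Set ℕ :=
  {d | ∃ Q : Matrix (Fin (Fintype.card ι + d)) (Fin (Fintype.card ι + d)) ℝ,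
    IsQuasiOrthogonalExtension Q S}

/-- The quasi-orthogonality index of a skew-symmetric matrix `S` of order `n`: the least `d` such
that `S` has a quasi-orthogonal extension of order `n + d`. Such a `d` exists for every
skew-symmetric `S`, see `isLeast_quasiOrthogonalityIndex`. -/
noncomputable def quasiOrthogonalityIndex {ι : Type*} [Fintype ι] (S : Matrix ι ι ℝ) : ℕ :=
  sInf (quasiOrthogonalityDefects S)

theorem exists_symm_commute_sqrt {ι : Type*} [Fintype ι] [DecidableEq ι] (S : Matrix ι ι ℝ)
    (hS : S.transpose = -S) :
    ∃ (q : ℝ) (B : Matrix ι ι ℝ), 0 < q ∧ B.transpose = B ∧ S * B = B * S ∧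
      B * B = q • (1 : Matrix ι ι ℝ) + S * S := by
  have hA : IsSelfAdjoint (-(S * S)) := by
    simp [IsSelfAdjoint, Matrix.star_eq_conjTranspose, hS]
  obtain ⟨q, hq⟩ := (Matrix.finite_real_spectrum (A := -(S * S))).bddAbove
  have hcont (f : ℝ → ℝ) : ContinuousOn f (spectrum ℝ (-(S * S))) :=
    (Matrix.finite_real_spectrum (A := -(S * S))).continuousOn f
  refine ⟨max q 1, cfc (fun x : ℝ => Real.sqrt (max q 1 - x)) (-(S * S)), by positivity, ?_, ?_, ?_⟩
  · have h : IsSelfAdjoint (cfc (fun x : ℝ => Real.sqrt (max q 1 - x)) (-(S * S))) :=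
      cfc_predicate _ _
    simpa [IsSelfAdjoint, Matrix.star_eq_conjTranspose] using h
  · have hc : Commute (-(S * S)) S := by
      simp [Commute, SemiconjBy, mul_assoc]
    exact (hc.cfc_real (fun x : ℝ => Real.sqrt (max q 1 - x))).symm
  · rw [← cfc_mul _ _ _ (hcont _) (hcont _)]
    have h : cfc (fun x : ℝ => Real.sqrt (max q 1 - x) * Real.sqrt (max q 1 - x)) (-(S * S))
        = cfc (fun x : ℝ => max q 1 - x) (-(S * S)) := by
      refine cfc_congr fun x hx => ?_
      have : x ≤ max q 1 := le_max_of_le_left (hq hx)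
      exact Real.mul_self_sqrt (by linarith)
    rw [h, cfc_sub _ _ _ (hcont _) (hcont _), cfc_const _ _ hA, cfc_id' ℝ _ hA,
      Algebra.algebraMap_eq_smul_one]
    simp

/-- Every skew-symmetric real matrix has a quasi-orthogonal extension. -/
theorem quasiOrthogonalityDefects_nonempty {ι : Type*} [Fintype ι] (S : Matrix ι ι ℝ)
    (hS : S.transpose = -S) : (quasiOrthogonalityDefects S).Nonempty := by
  classical
  obtain ⟨q, B, hq, hB, hc, hBB⟩ := exists_symm_commute_sqrt S hS
  have hcard : Fintype.card (ι ⊕ ι) = Fintype.card (Fin (Fintype.card ι + Fintype.card ι)) := by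
    simp
  let e : ι ⊕ ι ≃ Fin (Fintype.card ι + Fintype.card ι) := Fintype.equivOfCardEq hcard
  let M : Matrix (ι ⊕ ι) (ι ⊕ ι) ℝ := Matrix.fromBlocks S B (-B) (-S)
  have hM : M.transpose = -M := by
    simp [M, Matrix.fromBlocks_transpose, Matrix.fromBlocks_neg, hS, hB]
  have hMM : M.transpose * M = q • (1 : Matrix (ι ⊕ ι) (ι ⊕ ι) ℝ) := by
    rw [hM, ← Matrix.fromBlocks_one, Matrix.fromBlocks_smul]
    simp [M, Matrix.fromBlocks_neg, Matrix.fromBlocks_multiply, hc, hBB]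
  refine ⟨Fintype.card ι, M.submatrix e.symm e.symm, ?_, ⟨q, hq, ?_⟩,
    Function.Embedding.inl.trans e.toEmbedding, ?_⟩
  · rw [Matrix.transpose_submatrix, hM]
    rfl
  · rw [Matrix.transpose_submatrix, Matrix.submatrix_mul_equiv, hMM, Matrix.submatrix_smul]
    simp
  · ext i j
    simp [M]

/-- The index of a skew-symmetric matrix is a genuine minimum. -/
theorem isLeast_quasiOrthogonalityIndex {ι : Type*} [Fintype ι] (S : Matrix ι ι ℝ)
    (hS : S.transpose = -S) :
    IsLeast (quasiOrthogonalityDefects S) (quasiOrthogonalityIndex S) :=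
  ⟨Nat.sInf_mem (quasiOrthogonalityDefects_nonempty S hS), fun _ h => Nat.sInf_le h⟩

/-- A digraph is a tournament if it has no loops and every pair of distinct vertices is joined by
exactly one arc. -/
def Digraph.IsTournament {V : Type*} (T : Digraph V) : Prop :=
  (∀ v, ¬ T.Adj v v) ∧ ∀ u v, u ≠ v → Xor (T.Adj u v) (T.Adj v u)

open Classical in
/-- The skew-adjacency matrix: zero diagonal, and for `u ≠ v` the `(u, v)` entry is `1` if `u`
dominates `v` and `-1` otherwise. -/
noncomputable def Digraph.skewAdjMatrix {V : Type*} (T : Digraph V) : Matrix V V ℝ :=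
  Matrix.of fun u v => if u = v then 0 else if T.Adj u v then 1 else -1

/-- The skew-adjacency matrix of a tournament is skew-symmetric. -/
theorem Digraph.IsTournament.skewAdjMatrix_transpose {V : Type*} {T : Digraph V}
    (hT : T.IsTournament) : T.skewAdjMatrix.transpose = -T.skewAdjMatrix := by
  ext u v
  by_cases h : u = v
  · simp [skewAdjMatrix, h]
  · rcases hT.2 u v h with ⟨h1, h2⟩ | ⟨h1, h2⟩ <;>
      simp [skewAdjMatrix, h, Ne.symm h, h1, h2]

/-- The quasi-orthogonality index of a tournament. -/
noncomputable def Digraph.tournamentIndex {V : Type*} [Fintype V] (T : Digraph V) : ℕ :=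
  quasiOrthogonalityIndex T.skewAdjMatrix

/-- The skew-characteristic polynomial: the characteristic polynomial of the skew-adjacency
matrix. -/
noncomputable def Digraph.skewCharpoly {V : Type*} [Fintype V] [DecidableEq V] (T : Digraph V) :
    Polynomial ℝ :=
  T.skewAdjMatrix.charpoly

/-! An extension has blocks `S`, `B`, `-Bᵀ`, `D`, and quasi-orthogonality says `B Bᵀ = q + S²`, `Bᵀ
B = q + D²` and `S B + B D = 0`. So the rows of `B` are n vectors in ℝ^d of common squared length c
= q - (n - 1). Their inner products are integers congruent to n mod 2, and over each triangle of
vertices they sum to n mod 4. For d = 0 and d = 1 this forces 4 ∣ n and 4 ∣ n + 1 respectively;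
since n + d is even, the lower bounds follow.

Suppose d attains its bound. Comparing the traces of `B Bᵀ` and `Bᵀ B` gives (n - d) c ≤ d (n - 1),
with equality and hence c = d when d ≤ 1. For d = 2 and d = 3 (n ≥ 9) the inequality leaves c little
room, and d + 1 of the vectors have a singular Gram matrix, which the congruences allow only if c =
d (`sq_norm_eq_two_of_gram`, `sq_norm_eq_three_of_gram`). Then q = 4k + 3, the trace of `D²` is
known, and `charpoly_eq_of_blocks` yields the polynomial.

Conversely, the given polynomial makes q = 4k + 3 the largest eigenvalue of `-S²`, with multiplicity
n - d. Thus `q + S²` is positive semidefinite of rank d, and its square root supplies `B`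
(`mem_defects_of_charpoly_sq`). For n = 5 no condition is needed: the largest eigenvalue of `-S²` is
always at least double, so three rows suffice. -/

theorem scalar_eq_smul_one {m : Type*} [Fintype m] [DecidableEq m] (x : ℝ) :
    Matrix.scalar m x = x • (1 : Matrix m m ℝ) := by
  rw [Matrix.smul_one_eq_diagonal]; rfl

/-! ### Characteristic polynomials and block forms of extensions -/

open Polynomial in
/-- The characteristic polynomial of a skew-symmetric matrix squares to the characteristic
polynomial of the square of the matrix, evaluated at `X ^ 2`. -/
theorem charpoly_sq_eq_expand_of_skew {ι : Type*} [Fintype ι] [DecidableEq ι] {S : Matrix ι ι ℝ}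
    (hS : S.transpose = -S) : S.charpoly ^ 2 = expand ℝ 2 (S * S).charpoly := by
  refine Polynomial.funext fun x => ?_
  rw [expand_eval, eval_pow, Matrix.eval_charpoly, Matrix.eval_charpoly]
  have h : (Matrix.scalar ι x - S).det = (Matrix.scalar ι x + S).det := by
    rw [← Matrix.det_transpose, Matrix.transpose_sub, hS, sub_neg_eq_add]
    simp
  have hc : Matrix.scalar ι x * S = S * Matrix.scalar ι x :=
    Matrix.scalar_comm x (fun _ => mul_comm _ _) S
  calc (Matrix.scalar ι x - S).det ^ 2
      = ((Matrix.scalar ι x - S) * (Matrix.scalar ι x + S)).det := by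
        rw [Matrix.det_mul, ← h, sq]
    _ = _ := by
        congr 1
        rw [sub_mul, mul_add, mul_add, hc, map_pow, sq]
        abel

theorem card_mem_defects_of_blocks {ι κ : Type*} [Fintype ι] [Fintype κ] [DecidableEq ι]
    [DecidableEq κ] {Q : Matrix (ι ⊕ κ) (ι ⊕ κ) ℝ} (hQ : Q.transpose = -Q)
    (hq : IsQuasiOrthogonal Q) :
    Fintype.card κ ∈ quasiOrthogonalityDefects Q.toBlocks₁₁ := by
  let e : ι ⊕ κ ≃ Fin (Fintype.card ι + Fintype.card κ) := Fintype.equivOfCardEq (by simp)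
  obtain ⟨q, hq0, hqq⟩ := hq
  refine ⟨Q.submatrix e.symm e.symm, ?_, ⟨q, hq0, ?_⟩,
    Function.Embedding.inl.trans e.toEmbedding, ?_⟩
  · rw [Matrix.transpose_submatrix, hQ]
    rfl
  · rw [Matrix.transpose_submatrix, Matrix.submatrix_mul_equiv, hqq, Matrix.submatrix_smul]
    simp
  · ext i j
    simp [Matrix.toBlocks₁₁]

theorem exists_equiv_extending_embedding {ι : Type*} [Fintype ι] {d : ℕ}
    (f : ι ↪ Fin (Fintype.card ι + d)) :
    ∃ e : ι ⊕ Fin d ≃ Fin (Fintype.card ι + d), ∀ i, e (Sum.inl i) = f i := by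
  classical
  have hc : Fintype.card (Fin d) = Fintype.card ↥(Set.range f)ᶜ := by
    rw [Fintype.card_compl_set, Fintype.card_fin, Fintype.card_fin,
      Set.card_range_of_injective f.injective]
    omega
  refine ⟨(Equiv.sumCongr (Equiv.ofInjective f f.injective)
    (Fintype.equivOfCardEq hc)).trans (Equiv.Set.sumCompl (Set.range f)), fun i => ?_⟩
  simp

/-- The block form of a quasi-orthogonal extension by `d` rows and columns. -/
theorem exists_blocks_of_mem_defects {ι : Type*} [Fintype ι] [DecidableEq ι] {S : Matrix ι ι ℝ}
    (hS : S.transpose = -S) {d : ℕ} (h : d ∈ quasiOrthogonalityDefects S) :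
    ∃ (q : ℝ) (B : Matrix ι (Fin d) ℝ) (D : Matrix (Fin d) (Fin d) ℝ), 0 < q ∧
      D.transpose = -D ∧ B * B.transpose - S * S = q • (1 : Matrix ι ι ℝ) ∧
      B.transpose * B - D * D = q • (1 : Matrix (Fin d) (Fin d) ℝ) ∧ S * B + B * D = 0 := by
  obtain ⟨Q, hQ, ⟨q, hq, hqq⟩, f, hf⟩ := h
  obtain ⟨e, he⟩ := exists_equiv_extending_embedding f
  set R := Q.submatrix e e with hR
  have hRt : R.transpose = -R := by
    rw [hR, Matrix.transpose_submatrix, hQ]; rfl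
  have hRR : R.transpose * R = q • (1 : Matrix (ι ⊕ Fin d) (ι ⊕ Fin d) ℝ) := by
    rw [hR, Matrix.transpose_submatrix, Matrix.submatrix_mul_equiv, hqq, Matrix.submatrix_smul]
    simp
  have h11 : R.toBlocks₁₁ = S := by
    rw [← hf]; ext i j; simp [hR, Matrix.toBlocks₁₁, he]
  have hskew (a b) : R a b = -R b a := by
    simpa using congrFun (congrFun hRt b) a
  have h21 : R.toBlocks₂₁ = -R.toBlocks₁₂.transpose := by
    ext i j; simpa [Matrix.toBlocks₂₁, Matrix.toBlocks₁₂] using hskew (Sum.inr i) (Sum.inl j)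
  have h22 : R.toBlocks₂₂.transpose = -R.toBlocks₂₂ := by
    ext i j; simpa [Matrix.toBlocks₂₂] using hskew (Sum.inr j) (Sum.inr i)
  rw [← Matrix.fromBlocks_toBlocks R, h11, h21, Matrix.fromBlocks_transpose, hS, h22,
    Matrix.fromBlocks_multiply, ← Matrix.fromBlocks_one, Matrix.fromBlocks_smul,
    Matrix.fromBlocks_inj] at hRR
  obtain ⟨e1, e2, -, e4⟩ := hRR
  refine ⟨q, R.toBlocks₁₂, R.toBlocks₂₂, hq, h22, ?_, ?_, ?_⟩
  · rw [← e1]; simp; abel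
  · rw [← e4]; simp; abel
  · have := congrArg Neg.neg e2
    simpa [add_comm] using this

/-- The order of a skew-symmetric quasi-orthogonal matrix is even. -/
theorem even_card_of_skew_of_isQuasiOrthogonal {m : Type*} [Fintype m] [DecidableEq m]
    {Q : Matrix m m ℝ} (hQ : Q.transpose = -Q) (h : IsQuasiOrthogonal Q) :
    Even (Fintype.card m) := by
  obtain ⟨q, hq, hqq⟩ := h
  by_contra hodd
  rw [Nat.not_even_iff_odd] at hodd
  have h0 : Q.det = 0 := by
    have := congrArg Matrix.det hQ
    rw [Matrix.det_transpose, Matrix.det_neg, hodd.neg_one_pow] at this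
    linarith
  have := congrArg Matrix.det hqq
  rw [Matrix.det_mul, h0, mul_zero, Matrix.det_smul, Matrix.det_one, mul_one] at this
  exact (pow_pos hq _).ne this

theorem even_card_add_of_mem_defects {ι : Type*} [Fintype ι] {S : Matrix ι ι ℝ} {d : ℕ}
    (h : d ∈ quasiOrthogonalityDefects S) : Even (Fintype.card ι + d) := by
  obtain ⟨Q, hQ, hq, -⟩ := h
  simpa using even_card_of_skew_of_isQuasiOrthogonal hQ hq

-- The square of the characteristic polynomial is known from `Q * Q`; being monic fixes the sign of
-- the root.
open Polynomial in
theorem charpoly_of_skew_of_mul_self {m : Type*} [Fintype m] [DecidableEq m] {Q : Matrix m m ℝ}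
    (hQ : Q.transpose = -Q) {q : ℝ} (hqq : Q * Q = -(q • (1 : Matrix m m ℝ))) {N : ℕ}
    (hN : Fintype.card m = 2 * N) : Q.charpoly = (X ^ 2 + C q) ^ N := by
  have h1 := charpoly_sq_eq_expand_of_skew hQ
  have h2 : (Q * Q).charpoly = (X + C q) ^ (2 * N) := by
    refine Polynomial.funext fun x => ?_
    have : Matrix.scalar m x - Q * Q = (x + q) • (1 : Matrix m m ℝ) := by
      rw [hqq, sub_neg_eq_add, add_smul, scalar_eq_smul_one]
    rw [Matrix.eval_charpoly, this, Matrix.det_smul, hN]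
    simp
  rw [h2] at h1
  have h3 : Q.charpoly ^ 2 = ((X ^ 2 + C q) ^ N) ^ 2 := by
    rw [h1]; simp [← pow_mul, mul_comm]
  rcases sq_eq_sq_iff_eq_or_eq_neg.1 h3 with h | h
  · exact h
  · have m1 := Q.charpoly_monic
    have m2 : ((X ^ 2 + C q) ^ N : ℝ[X]).Monic := (monic_X_pow_add_C q two_ne_zero).pow N
    rw [h, Monic, leadingCoeff_neg, m2.leadingCoeff] at m1
    norm_num at m1

open Polynomial in
/-- Complementary blocks of a skew-symmetric quasi-orthogonal matrix have characteristic
polynomials which differ by a power of `X ^ 2 + q`. -/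
theorem charpoly_eq_of_blocks {ι κ : Type*} [Fintype ι] [DecidableEq ι] [Fintype κ]
    [DecidableEq κ] {S : Matrix ι ι ℝ} {B : Matrix ι κ ℝ} {D : Matrix κ κ ℝ} {q : ℝ}
    (hS : S.transpose = -S) (hD : D.transpose = -D)
    (h11 : B * B.transpose - S * S = q • (1 : Matrix ι ι ℝ))
    (h22 : B.transpose * B - D * D = q • (1 : Matrix κ κ ℝ)) (h12 : S * B + B * D = 0)
    {a : ℕ} (ha : Fintype.card ι = 2 * a + Fintype.card κ) :
    S.charpoly = (X ^ 2 + C q) ^ a * D.charpoly := by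
  set Q := Matrix.fromBlocks S B (-B.transpose) D with hQdef
  have hQ : Q.transpose = -Q := by
    simp [hQdef, Matrix.fromBlocks_transpose, Matrix.fromBlocks_neg, hS, hD]
  have h21 : B.transpose * S + D * B.transpose = 0 := by
    have := congrArg Matrix.transpose h12
    simp only [Matrix.transpose_add, Matrix.transpose_mul, hS, hD, Matrix.transpose_zero] at this
    have := congrArg Neg.neg this
    simpa [add_comm] using this
  have hQQ : Q * Q = -(q • (1 : Matrix (ι ⊕ κ) (ι ⊕ κ) ℝ)) := by
    rw [hQdef, Matrix.fromBlocks_multiply, ← Matrix.fromBlocks_one, Matrix.fromBlocks_smul,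
      Matrix.fromBlocks_neg, Matrix.fromBlocks_inj, ← h11, ← h22, h12]
    refine ⟨by simp; abel, by simp, ?_, by simp; abel⟩
    have := congrArg Neg.neg h21
    simp only [smul_zero, neg_zero, Matrix.neg_mul, Matrix.mul_neg] at this ⊢
    rw [← this]; abel
  have hχQ := charpoly_of_skew_of_mul_self hQ hQQ (N := a + Fintype.card κ) (by simp; omega)
  have hmonic : ((X ^ 2 + C q) ^ Fintype.card κ : ℝ[X]).Monic :=
    (monic_X_pow_add_C q two_ne_zero).pow _
  refine hmonic.isRegular.right ?_
  suffices h : Q.charpoly * D.charpoly = S.charpoly * (X ^ 2 + C q) ^ Fintype.card κ by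
    simp only [← h, hχQ]; ring
  refine Polynomial.funext fun x => ?_
  have hDt : (Matrix.scalar κ x - D).det = (Matrix.scalar κ x + D).det := by
    rw [← Matrix.det_transpose, Matrix.transpose_sub, hD, sub_neg_eq_add]
    simp
  rw [eval_mul, eval_mul, Matrix.eval_charpoly, Matrix.eval_charpoly, Matrix.eval_charpoly, hDt]
  -- The second factor is chosen to clear the upper right block, by `S B + B D = 0`; the lower right
  -- one becomes `Bᵀ B + (x - D)(x + D) = x² + q`.
  have hfac : (Matrix.scalar (ι ⊕ κ) x - Q) *
      Matrix.fromBlocks 1 B 0 (Matrix.scalar κ x + D) =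
      Matrix.fromBlocks (Matrix.scalar ι x - S) 0 B.transpose
        ((x ^ 2 + q) • (1 : Matrix κ κ ℝ)) := by
    have h0 : Matrix.scalar (ι ⊕ κ) x - Q = Matrix.fromBlocks (Matrix.scalar ι x - S) (-B)
        B.transpose (Matrix.scalar κ x - D) := by
      simp only [scalar_eq_smul_one, hQdef, ← Matrix.fromBlocks_one,
        Matrix.fromBlocks_smul, sub_eq_add_neg, Matrix.fromBlocks_neg, Matrix.fromBlocks_add]
      simp
    rw [h0, Matrix.fromBlocks_multiply, Matrix.fromBlocks_inj]
    simp only [scalar_eq_smul_one]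
    refine ⟨by simp, ?_, by simp, ?_⟩
    · simp only [Matrix.sub_mul, Matrix.neg_mul, Matrix.mul_add, Matrix.smul_mul, Matrix.mul_smul, Matrix.one_mul, Matrix.mul_one]
      rw [eq_neg_of_add_eq_zero_left h12]; module
    · simp only [Matrix.sub_mul, Matrix.mul_add, Matrix.smul_mul, Matrix.mul_smul, Matrix.one_mul, Matrix.mul_one]
      rw [add_smul, ← h22, sq]; module
  have := congrArg Matrix.det hfac
  rw [Matrix.det_mul, Matrix.det_fromBlocks_zero₁₂, Matrix.det_fromBlocks_zero₂₁, Matrix.det_one,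
    one_mul, Matrix.det_smul, Matrix.det_one, mul_one] at this
  rw [this]
  simp

/-! ### Extensions built from the spectrum of `S * S` -/

/-- A skew-symmetric matrix whose square is diagonal with entries `lam i ≥ -q` can be completed to
a quasi-orthogonal matrix using one new row for each `i` with `lam i ≠ -q`. -/
theorem exists_blocks_of_mul_self_diagonal {ι : Type*} [Fintype ι] [DecidableEq ι]
    {A : Matrix ι ι ℝ} (hA : A.transpose = -A) {lam : ι → ℝ} (hl : A * A = Matrix.diagonal lam)
    {q : ℝ} (hq : ∀ i, -q ≤ lam i) :
    ∃ (B : Matrix ι {i // lam i ≠ -q} ℝ) (D : Matrix {i // lam i ≠ -q} {i // lam i ≠ -q} ℝ),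
      D.transpose = -D ∧ B * B.transpose - A * A = q • (1 : Matrix ι ι ℝ) ∧
      B.transpose * B - D * D = q • (1 : Matrix _ _ ℝ) ∧ A * B + B * D = 0 := by
  have hcomm (i j) : A i j * lam j = lam i * A i j := by
    have : A * Matrix.diagonal lam = Matrix.diagonal lam * A := by
      rw [← hl, mul_assoc A A A]
    simpa [Matrix.mul_diagonal, Matrix.diagonal_mul] using congrFun (congrFun this i) j
  have hzero (i j) (h : lam i ≠ lam j) : A i j = 0 := by
    have := hcomm i j
    have h2 : A i j * (lam j - lam i) = 0 := by linarith
    exact (mul_eq_zero.1 h2).resolve_right (sub_ne_zero.2 h.symm)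
  have hr (i) : Real.sqrt (q + lam i) * Real.sqrt (q + lam i) = q + lam i :=
    Real.mul_self_sqrt (by linarith [hq i])
  have hsqrt0 (i) (h : lam i = -q) : Real.sqrt (q + lam i) = 0 := by simp [h]
  have hsum (f : ι → ℝ) (hf : ∀ i, lam i = -q → f i = 0) :
      ∑ k : {i // lam i ≠ -q}, f k = ∑ i, f i := by
    rw [← Finset.sum_subtype (Finset.univ.filter fun i => lam i ≠ -q) (by simp) f]
    exact Finset.sum_filter_of_ne fun i _ hi h => hi (hf i h)
  -- `B` consists of the nonzero columns of the diagonal root of `q + A²`, and `D` is the matching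
  -- block of `-A`. The root commutes with `A`, and `A` has no entries linking kept and dropped
  -- indices, so dropping loses nothing.
  refine ⟨Matrix.of fun i k => if i = k.1 then Real.sqrt (q + lam i) else 0,
    Matrix.of fun i j => -A i j, ?_, ?_, ?_, ?_⟩
  · ext i j
    simpa using congrArg Neg.neg (congrFun (congrFun hA i.1) j.1)
  · rw [hl]
    ext i j
    simp only [Matrix.sub_apply, Matrix.mul_apply, Matrix.transpose_apply, Matrix.of_apply]
    rw [hsum fun k => (if i = k then Real.sqrt (q + lam i) else 0) *
      (if j = k then Real.sqrt (q + lam j) else 0)]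
    · by_cases hij : i = j
      · subst hij; simp [hr]
      · simp [hij]
    · intro k hk
      by_cases hik : i = k
      · subst hik; simp [hsqrt0 _ hk]
      · simp [hik]
  · ext i j
    have hsq := congrFun (congrFun hl i.1) j.1
    rw [Matrix.mul_apply, ← hsum fun k => A i k * A k j] at hsq
    · simp only [Matrix.sub_apply, Matrix.mul_apply, Matrix.transpose_apply, Matrix.of_apply,
        neg_mul_neg]
      rw [hsq]
      by_cases hij : i = j
      · subst hij; simp [hr]
      · have : i.1 ≠ j.1 := fun h => hij (Subtype.ext h)
        simp [hij, this, this.symm]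
    · intro k hk
      rw [hzero i k (by rw [hk]; exact i.2), zero_mul]
  · ext i j
    simp only [Matrix.add_apply, Matrix.mul_apply, Matrix.of_apply, Matrix.zero_apply]
    rw [hsum fun k => (if i = k then Real.sqrt (q + lam i) else 0) * -A k j]
    · simp only [mul_ite, mul_zero, ite_mul, zero_mul, Finset.sum_ite_eq, Finset.mem_univ,
        if_true, Finset.sum_ite_eq']
      by_cases h : lam i = lam j
      · rw [h]; ring
      · rw [hzero _ _ h]; ring
    · intro k hk
      by_cases hik : i = k
      · subst hik; simp [hsqrt0 _ hk]
      · simp [hik]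

/-- Orthogonal diagonalisation of the square of a skew-symmetric matrix. -/
theorem exists_orthogonal_mul_self_diagonal {ι : Type*} [Fintype ι] [DecidableEq ι]
    {S : Matrix ι ι ℝ} (hS : S.transpose = -S) :
    ∃ (U : Matrix ι ι ℝ) (lam : ι → ℝ), U.transpose * U = 1 ∧ U * U.transpose = 1 ∧
      (U.transpose * S * U) * (U.transpose * S * U) = Matrix.diagonal lam ∧
      (S * S).charpoly = ∏ i, (Polynomial.X - Polynomial.C (lam i)) := by
  have hH : (S * S).IsHermitian := by
    rw [Matrix.IsHermitian, Matrix.conjTranspose_eq_transpose_of_trivial, Matrix.transpose_mul, hS]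
    simp
  have hU : (hH.eigenvectorUnitary : Matrix ι ι ℝ) * (hH.eigenvectorUnitary : Matrix ι ι ℝ).transpose
      = 1 := by
    simpa [Matrix.star_eq_conjTranspose] using Unitary.coe_mul_star_self hH.eigenvectorUnitary
  have hU' : (hH.eigenvectorUnitary : Matrix ι ι ℝ).transpose * (hH.eigenvectorUnitary : Matrix ι ι ℝ)
      = 1 := mul_eq_one_comm.1 hU
  refine ⟨hH.eigenvectorUnitary, hH.eigenvalues, hU', hU, ?_, by simpa using hH.charpoly_eq⟩
  have h := hH.conjStarAlgAut_star_eigenvectorUnitary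
  rw [Unitary.conjStarAlgAut_apply] at h
  simp only [Unitary.coe_star, Matrix.star_eq_conjTranspose,
    Matrix.conjTranspose_eq_transpose_of_trivial, Matrix.transpose_transpose] at h
  set U := (hH.eigenvectorUnitary : Matrix ι ι ℝ)
  calc (U.transpose * S * U) * (U.transpose * S * U)
      = U.transpose * S * (U * U.transpose) * S * U := by simp only [mul_assoc]
    _ = U.transpose * (S * S) * U := by rw [hU, mul_one]; simp only [mul_assoc]
    _ = _ := by rw [h]; rfl

/-- If `-q` is a lower bound of the eigenvalues `lam` of `S * S`, then `S` has a quasi-orthogonal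
extension by as many rows as there are eigenvalues different from `-q`. -/
theorem card_ne_mem_defects {ι : Type*} [Fintype ι] [DecidableEq ι]
    {S U : Matrix ι ι ℝ} (hS : S.transpose = -S) {lam : ι → ℝ} (hU : U * U.transpose = 1)
    (hl : (U.transpose * S * U) * (U.transpose * S * U) = Matrix.diagonal lam)
    {q : ℝ} (hq0 : 0 < q) (hq : ∀ i, -q ≤ lam i) :
    Fintype.card {i // lam i ≠ -q} ∈ quasiOrthogonalityDefects S := by
  have hA : (U.transpose * S * U).transpose = -(U.transpose * S * U) := by
    simp [Matrix.transpose_mul, hS, mul_assoc]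
  obtain ⟨B, D, hD, h11, h22, h12⟩ := exists_blocks_of_mul_self_diagonal hA hl hq
  set A := U.transpose * S * U with hAdef
  have hUA : U * A = S * U := by
    rw [hAdef, ← mul_assoc, ← mul_assoc, hU, one_mul]
  have hAU : A * U.transpose = U.transpose * S := by
    rw [hAdef, mul_assoc, hU, mul_one]
  -- Undoing the conjugation changes only the old coordinates: `B` becomes `U * B` and `D` stays.
  have hBB : (U * B) * (U * B).transpose - S * S = q • (1 : Matrix ι ι ℝ) := by
    have h1 : U * (B * B.transpose - A * A) * U.transpose = q • (1 : Matrix ι ι ℝ) := by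
      rw [h11]; simp [hU]
    rw [← h1, mul_sub, sub_mul, Matrix.transpose_mul, ← mul_assoc U A A, hUA, mul_assoc (S * U),
      hAU, mul_assoc S U, ← mul_assoc U, hU, one_mul]
    simp only [Matrix.mul_assoc]
  have hB2 : (U * B).transpose * (U * B) = B.transpose * B := by
    rw [Matrix.transpose_mul, Matrix.mul_assoc, ← Matrix.mul_assoc U.transpose,
      mul_eq_one_comm.1 hU, Matrix.one_mul]
  have hB12 : S * (U * B) + (U * B) * D = 0 := by
    rw [← Matrix.mul_assoc, ← hUA, Matrix.mul_assoc U A, Matrix.mul_assoc U B, ← Matrix.mul_add, h12,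
      Matrix.mul_zero]
  have hB21 : D * (U * B).transpose + (U * B).transpose * S = 0 := by
    have := congrArg Matrix.transpose hB12
    rw [Matrix.transpose_add, Matrix.transpose_mul, Matrix.transpose_mul (U * B), hS, hD] at this
    have := congrArg Neg.neg this
    simpa [add_comm] using this
  have := card_mem_defects_of_blocks
    (Q := Matrix.fromBlocks S (U * B) (-(U * B).transpose) D)
    (by simp [Matrix.fromBlocks_transpose, Matrix.fromBlocks_neg, hS, hD])
    ⟨q, hq0, by
      rw [Matrix.fromBlocks_transpose, Matrix.fromBlocks_multiply, ← Matrix.fromBlocks_one,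
        Matrix.fromBlocks_smul, Matrix.fromBlocks_inj]
      rw [← hB2] at h22
      rw [hS, hD, ← hBB, ← h22]
      refine ⟨?_, ?_, ?_, ?_⟩
      · simp; abel
      · have := congrArg Neg.neg hB12
        simp only [Matrix.transpose_neg, Matrix.transpose_transpose, Matrix.neg_mul, smul_zero,
          neg_zero] at this ⊢
        rw [← this]; abel
      · simp only [Matrix.neg_mul, Matrix.mul_neg, neg_neg, smul_zero]
        rw [← hB21]; abel
      · simp; abel⟩
  simpa using this

open Polynomial in
/-- If `S` is skew-symmetric of order `d + m`, and the characteristic polynomial of `S` squares to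
`(X ^ 2 + q) ^ m * R (X ^ 2)` where all roots of `R` exceed `-q`, then `S` has a quasi-orthogonal
extension by `d` rows. -/
theorem mem_defects_of_charpoly_sq {ι : Type*} [Fintype ι] [DecidableEq ι]
    {S : Matrix ι ι ℝ} (hS : S.transpose = -S) {q : ℝ} (hq0 : 0 < q) {R : ℝ[X]}
    (hR : ∀ r, R.eval r = 0 → -q < r) {d m : ℕ} (hcard : Fintype.card ι = d + m)
    (hχ : S.charpoly ^ 2 = expand ℝ 2 ((X + C q) ^ m * R)) :
    d ∈ quasiOrthogonalityDefects S := by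
  obtain ⟨U, lam, -, hU, hl, hprod⟩ := exists_orthogonal_mul_self_diagonal hS
  have hχ' : (S * S).charpoly = (X + C q) ^ m * R := by
    refine expand_injective two_pos ?_
    rw [← hχ, charpoly_sq_eq_expand_of_skew hS]
  have hR0 : R ≠ 0 := by
    rintro rfl
    exact (S * S).charpoly_monic.ne_zero (by simpa using hχ')
  have hlow (i) : -q ≤ lam i := by
    have h1 : (S * S).charpoly.eval (lam i) = 0 := by
      rw [hprod, eval_prod]
      exact Finset.prod_eq_zero (Finset.mem_univ i) (by simp)
    rw [hχ', eval_mul] at h1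
    rcases mul_eq_zero.1 h1 with h | h
    · have h2 : lam i + q = 0 := by
        have := eq_zero_of_pow_eq_zero (by simpa using h : (lam i + q) ^ m = 0)
        exact this
      linarith
    · exact (hR _ h).le
  have hcount : Fintype.card {i // lam i = -q} = m := by
    have h1 : (S * S).charpoly.roots.count (-q) = Fintype.card {i // lam i = -q} := by
      have h2 : ∏ i, (X - C (lam i)) = ((Finset.univ.val.map lam).map fun a => X - C a).prod := by
        rw [Multiset.map_map]; rfl
      rw [hprod, h2, roots_multiset_prod_X_sub_C, Multiset.count_map, Fintype.card_subtype]
      simp [Finset.card, Finset.filter, eq_comm]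
    rw [← h1, hχ', roots_mul (by rw [← hχ']; exact (S * S).charpoly_monic.ne_zero),
      Multiset.count_add, roots_pow, Multiset.count_nsmul]
    have h2 : R.roots.count (-q) = 0 := by
      rw [Multiset.count_eq_zero, mem_roots hR0]
      exact fun h => (hR _ h).false
    have h3 : (X + C q : ℝ[X]).roots = {-q} := roots_X_add_C q
    simp [h2, h3]
  have hd : Fintype.card {i // lam i ≠ -q} = d := by
    have := Fintype.card_subtype_compl (fun i => lam i = -q)
    rw [hcount, hcard] at this
    simpa using this
  rw [← hd]
  exact card_ne_mem_defects hS hU hl hq0 hlow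

/-- A nonzero skew-symmetric matrix of order at least two has a quasi-orthogonal extension by at
most two rows less than its order. -/
theorem exists_mem_defects_add_two_le {ι : Type*} [Fintype ι] [DecidableEq ι] {S : Matrix ι ι ℝ}
    (hS : S.transpose = -S) (h0 : S ≠ 0) :
    ∃ d ∈ quasiOrthogonalityDefects S, d + 2 ≤ Fintype.card ι := by
  obtain ⟨U, lam, -, hU, hl, -⟩ := exists_orthogonal_mul_self_diagonal hS
  have hA : (U.transpose * S * U).transpose = -(U.transpose * S * U) := by
    simp [Matrix.transpose_mul, hS, mul_assoc]
  have hSA : S = U * (U.transpose * S * U) * U.transpose := by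
    rw [mul_assoc, mul_assoc _ U, hU, mul_one, ← mul_assoc, hU, one_mul]
  have hA0 : U.transpose * S * U ≠ 0 := by
    intro h
    rw [h] at hSA
    exact h0 (by simpa using hSA)
  set A := U.transpose * S * U with hAdef
  have hskew (i j) : A i j = -A j i := by simpa using congrFun (congrFun hA j) i
  have hlam (i) : lam i = -∑ j, A i j ^ 2 := by
    have := congrFun (congrFun hl i) i
    rw [Matrix.diagonal_apply_eq, Matrix.mul_apply] at this
    rw [← this, ← Finset.sum_neg_distrib]
    exact Finset.sum_congr rfl fun j _ => by rw [hskew j i]; ring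
  obtain ⟨a, b, hab⟩ : ∃ a b, A a b ≠ 0 := by
    by_contra! h
    exact hA0 (by ext i j; simpa using h i j)
  have : Nonempty ι := ⟨a⟩
  obtain ⟨i, hi⟩ := Finite.exists_min lam
  have hneg : lam i < 0 := by
    refine (hi a).trans_lt ?_
    rw [hlam, neg_lt_zero]
    exact Finset.sum_pos' (fun j _ => sq_nonneg _) ⟨b, Finset.mem_univ b, by positivity⟩
  have hcomm (i j) : A i j * lam j = lam i * A i j := by
    have : A * Matrix.diagonal lam = Matrix.diagonal lam * A := by
      rw [← hl, mul_assoc A A A]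
    simpa [Matrix.mul_diagonal, Matrix.diagonal_mul] using congrFun (congrFun this i) j
  -- The least eigenvalue is not simple: `A` preserves the eigenspaces of its square, so otherwise
  -- row `i` would reduce to `A i i = 0` and `lam i` would vanish.
  obtain ⟨j, hij, hj⟩ : ∃ j, i ≠ j ∧ lam j = lam i := by
    by_contra! h
    have hrow (j) : A i j = 0 := by
      by_cases hij : i = j
      · subst hij; linarith [hskew i i]
      · have h1 : A i j * (lam j - lam i) = 0 := by linarith [hcomm i j]
        exact (mul_eq_zero.1 h1).resolve_right (sub_ne_zero.2 (h j hij))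
    rw [hlam] at hneg
    simp [hrow] at hneg
  refine ⟨_, card_ne_mem_defects hS hU hl (q := -lam i) (by linarith) (by simpa using hi), ?_⟩
  have h1 := Fintype.card_subtype_compl (fun k => lam k = - -lam i)
  have h2 : 2 ≤ Fintype.card {k // lam k = - -lam i} := by
    have := Fintype.one_lt_card_iff.2
      ⟨(⟨i, by simp⟩ : {k // lam k = - -lam i}), ⟨j, by simp [hj]⟩, by simpa using hij⟩
    omega
  have h3 := Fintype.card_subtype_le (fun k => lam k = - -lam i)
  simp only [ne_eq] at h1 ⊢
  omega

/-! ### Congruences for the Gram matrix of a tournament -/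

/-- Column inner products of a skew tournament matrix have the parity of its order. -/
theorem two_dvd_gram_add_card {V : Type*} [Fintype V] [DecidableEq V] {Z : V → V → ℤ}
    (h0 : ∀ u, Z u u = 0) (h1 : ∀ u v, u ≠ v → Z u v = 1 ∨ Z u v = -1) {i j : V} (hij : i ≠ j) :
    (2 : ℤ) ∣ ∑ l, Z l i * Z l j + Fintype.card V := by
  have h : ∑ l, Z l i * Z l j + Fintype.card V = ∑ l, (Z l i * Z l j + 1) := by
    simp [Finset.sum_add_distrib]
  rw [h, ← Finset.sum_add_sum_compl {i, j}, Finset.sum_pair hij, h0, h0]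
  refine dvd_add (by norm_num) (Finset.dvd_sum fun l hl => ?_)
  simp only [Finset.mem_compl, Finset.mem_insert, Finset.mem_singleton, not_or] at hl
  rcases h1 l i hl.1 with e1 | e1 <;> rcases h1 l j hl.2 with e2 | e2 <;> rw [e1, e2] <;> norm_num

/-- For `l` outside the triangle, signs x, y, z give xy + yz + xz + 1 ∈ {0, 4}. The three remaining
`l` contribute 3 plus a sum of three signs with product -1, again 0 or 4. -/
theorem four_dvd_gram_add_gram_add_gram_add_card {V : Type*} [Fintype V] [DecidableEq V]
    {Z : V → V → ℤ} (h0 : ∀ u, Z u u = 0) (h1 : ∀ u v, u ≠ v → Z u v = 1 ∨ Z u v = -1)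
    (hs : ∀ u v, Z v u = -Z u v) {i j k : V} (hij : i ≠ j) (hjk : j ≠ k) (hik : i ≠ k) :
    (4 : ℤ) ∣ ∑ l, Z l i * Z l j + ∑ l, Z l j * Z l k + ∑ l, Z l i * Z l k
      + Fintype.card V := by
  have h : ∑ l, Z l i * Z l j + ∑ l, Z l j * Z l k + ∑ l, Z l i * Z l k + Fintype.card V
      = ∑ l, (Z l i * Z l j + Z l j * Z l k + Z l i * Z l k + 1) := by
    simp [Finset.sum_add_distrib]
  rw [h, ← Finset.sum_add_sum_compl {i, j, k}]
  refine dvd_add ?_ (Finset.dvd_sum fun l hl => ?_)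
  · rw [Finset.sum_insert (by simp [hij, hik]), Finset.sum_pair hjk, h0, h0, h0, hs i j, hs j k,
      hs i k]
    rcases h1 i j hij with e1 | e1 <;> rcases h1 j k hjk with e2 | e2 <;>
      rcases h1 i k hik with e3 | e3 <;> rw [e1, e2, e3] <;> norm_num
  · simp only [Finset.mem_compl, Finset.mem_insert, Finset.mem_singleton, not_or] at hl
    rcases h1 l i hl.1 with e1 | e1 <;> rcases h1 l j hl.2.1 with e2 | e2 <;>
      rcases h1 l k hl.2.2 with e3 | e3 <;> rw [e1, e2, e3] <;> norm_num

theorem gram_self {V : Type*} [Fintype V] [DecidableEq V] {Z : V → V → ℤ}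
    (h0 : ∀ u, Z u u = 0) (h1 : ∀ u v, u ≠ v → Z u v = 1 ∨ Z u v = -1) (i : V) :
    ∑ l, Z l i * Z l i = Fintype.card V - 1 := by
  have h (l : V) : Z l i * Z l i = if l = i then 0 else 1 := by
    split_ifs with hl
    · rw [hl, h0]; rfl
    · rcases h1 l i hl with e | e <;> rw [e] <;> rfl
  have h2 (l : V) : (if l = i then 0 else 1 : ℤ) = 1 - if l = i then 1 else 0 := by
    split_ifs <;> rfl
  simp only [h, h2, Finset.sum_sub_distrib]
  simp

theorem Digraph.IsTournament.exists_int_skewAdjMatrix {V : Type*} {T : Digraph V}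
    (hT : T.IsTournament) : ∃ Z : V → V → ℤ, (∀ u v, T.skewAdjMatrix u v = Z u v) ∧
      (∀ u, Z u u = 0) ∧ (∀ u v, u ≠ v → Z u v = 1 ∨ Z u v = -1) ∧ ∀ u v, Z v u = -Z u v := by
  classical
  have hZ (u v) : T.skewAdjMatrix u v =
      ((if u = v then 0 else if T.Adj u v then 1 else -1 : ℤ) : ℝ) := by
    simp only [skewAdjMatrix, Matrix.of_apply]
    split_ifs <;> simp
  refine ⟨fun u v => if u = v then 0 else if T.Adj u v then 1 else -1, hZ, by simp, ?_, ?_⟩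
  · intro u v h
    simp only [h, if_false]
    split_ifs <;> simp
  · intro u v
    have h := congrFun (congrFun hT.skewAdjMatrix_transpose u) v
    rw [Matrix.transpose_apply, Matrix.neg_apply, hZ, hZ] at h
    exact_mod_cast h

/-! ### Few vectors in small dimension -/

theorem sum_sum_mul_gram {ι κ : Type*} [Fintype ι] [Fintype κ] (u : ι → κ → ℝ) (w : ι → ℝ) :
    ∑ i, ∑ j, w i * w j * ∑ k, u i k * u j k = ∑ k, (∑ i, w i * u i k) ^ 2 := by
  simp only [sq, Finset.sum_mul_sum]
  simp only [Finset.mul_sum]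
  rw [Finset.sum_comm (s := (Finset.univ : Finset κ))]
  refine Finset.sum_congr rfl fun i _ => ?_
  rw [Finset.sum_comm (s := (Finset.univ : Finset κ))]
  refine Finset.sum_congr rfl fun j _ => Finset.sum_congr rfl fun k _ => ?_
  ring

theorem sum_sum_mul_gram_nonneg {ι κ : Type*} [Fintype ι] [Fintype κ] (u : ι → κ → ℝ)
    (w : ι → ℝ) : 0 ≤ ∑ i, ∑ j, w i * w j * ∑ k, u i k * u j k := by
  rw [sum_sum_mul_gram]
  exact Finset.sum_nonneg fun _ _ => sq_nonneg _

/-- A linear dependence among the vectors is a null vector of their Gram form. -/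
theorem exists_sum_sum_mul_gram_eq_zero {d m : ℕ} (hdm : d < m) (u : Fin m → Fin d → ℝ) :
    ∃ v : Fin m → ℝ, 0 < ∑ i, v i ^ 2 ∧
      ∑ i, ∑ j, v i * v j * ∑ k, u i k * u j k = 0 := by
  have h : ¬ LinearIndependent ℝ u := fun h => by
    have := h.fintype_card_le_finrank
    simp at this
    omega
  obtain ⟨v, hv, i, hi⟩ := Fintype.not_linearIndependent_iff.1 h
  refine ⟨v, Finset.sum_pos' (fun _ _ => sq_nonneg _) ⟨i, Finset.mem_univ i, by positivity⟩, ?_⟩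
  rw [sum_sum_mul_gram]
  refine Finset.sum_eq_zero fun k _ => ?_
  have := congrFun hv k
  simp only [Finset.sum_apply, Pi.smul_apply, smul_eq_mul, Pi.zero_apply] at this
  rw [this]; ring

/-- Three vectors of the plane with the same squared length `c ≤ 5 / 2` whose inner products are
even integers with sum `2` modulo `4` have `c = 2`. -/
theorem sq_norm_eq_two_of_gram {c : ℝ} (hc : c ≤ 5 / 2) (u : Fin 3 → Fin 2 → ℝ)
    (hu : ∀ i, ∑ k, u i k * u i k = c) {a b e : ℤ} (ha : ∑ k, u 0 k * u 1 k = a)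
    (hb : ∑ k, u 0 k * u 2 k = b) (he : ∑ k, u 1 k * u 2 k = e) (ha2 : 2 ∣ a) (hb2 : 2 ∣ b)
    (he2 : 2 ∣ e) (h4 : 4 ∣ a + e + b - 2) : c = 2 := by
  have ha' : ∑ k, u 1 k * u 0 k = a := by rw [← ha]; simp only [mul_comm]
  have hb' : ∑ k, u 2 k * u 0 k = b := by rw [← hb]; simp only [mul_comm]
  have he' : ∑ k, u 2 k * u 1 k = e := by rw [← he]; simp only [mul_comm]
  have hpsd (x y z : ℝ) :
      0 ≤ c * (x ^ 2 + y ^ 2 + z ^ 2) + 2 * (x * y * a + x * z * b + y * z * e) := by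
    refine (sum_sum_mul_gram_nonneg u ![x, y, z]).trans_eq ?_
    simp only [Fin.sum_univ_three, Matrix.cons_val, hu, ha, hb, he, ha', hb', he']
    ring
  obtain ⟨v, hv, hker⟩ := exists_sum_sum_mul_gram_eq_zero (by norm_num) u
  simp only [Fin.sum_univ_three, hu, ha, hb, he, ha', hb', he'] at hv hker
  have hbound (x : ℤ) (hx : 2 ∣ x) (h1 : (x : ℝ) ≤ c) (h2 : -c ≤ (x : ℝ)) :
      x = 2 ∨ x = 0 ∨ x = -2 := by
    have h3 : (x : ℝ) < 3 := by linarith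
    have h4 : (-3 : ℝ) < x := by linarith
    norm_cast at h3
    have h5 : -3 < x := by exact_mod_cast h4
    omega
  have hA := hbound a ha2 (by linarith [hpsd 1 (-1) 0]) (by linarith [hpsd 1 1 0])
  have hB := hbound b hb2 (by linarith [hpsd 1 0 (-1)]) (by linarith [hpsd 1 0 1])
  have hE := hbound e he2 (by linarith [hpsd 0 1 (-1)]) (by linarith [hpsd 0 1 1])
  have p1 := hpsd 1 1 0
  have p2 := hpsd 1 (-1) 0
  have p3 := hpsd 1 0 1
  have p4 := hpsd 1 0 (-1)
  have p5 := hpsd 0 1 1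
  have p6 := hpsd 0 1 (-1)
  have p7 := hpsd 1 1 1
  have p8 := hpsd 1 1 (-1)
  have p9 := hpsd 1 (-1) 1
  have p10 := hpsd 1 (-1) (-1)
  by_contra hne
  -- The sum being 2 mod 4, an odd number of the inner products is ±2, and one such entry already
  -- forces c ≥ 2.
  have hlt : 2 < c := by
    refine lt_of_le_of_ne ?_ (Ne.symm hne)
    rcases hA with rfl | rfl | rfl <;> rcases hB with rfl | rfl | rfl <;>
      rcases hE with rfl | rfl | rfl <;> first | (exfalso; omega) | (push_cast at *; linarith)
  -- The surviving forms are (c - 2)|v|² plus a sum of squares, so they cannot vanish at `v`. Three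
  -- entries ±2 with negative product would need c ≥ 4.
  have hpos := mul_pos (sub_pos.2 hlt) hv
  rcases hA with rfl | rfl | rfl <;> rcases hB with rfl | rfl | rfl <;>
    rcases hE with rfl | rfl | rfl <;> first
    | (exfalso; omega)
    | (push_cast at *
       linarith [sq_nonneg (v 0), sq_nonneg (v 1), sq_nonneg (v 2), sq_nonneg (v 0 + v 1),
        sq_nonneg (v 0 - v 1), sq_nonneg (v 0 + v 2), sq_nonneg (v 0 - v 2),
        sq_nonneg (v 1 + v 2), sq_nonneg (v 1 - v 2), sq_nonneg (v 0 + v 1 + v 2),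
        sq_nonneg (v 0 + v 1 - v 2), sq_nonneg (v 0 - v 1 + v 2), sq_nonneg (v 0 - v 1 - v 2)])

/-- Four vectors of the space with the same squared length `c ≤ 4` and inner products in `{-1, 3}`
have `c = 3`. -/
theorem sq_norm_eq_three_of_gram_mem {c : ℝ} (hc : c ≤ 4) (u : Fin 4 → Fin 3 → ℝ)
    (hu : ∀ i, ∑ k, u i k * u i k = c)
    (hm : ∀ i j, i ≠ j → ∑ k, u i k * u j k = -1 ∨ ∑ k, u i k * u j k = 3) : c = 3 := by
  have hsymm (i j) : ∑ k, u i k * u j k = ∑ k, u j k * u i k := by simp only [mul_comm]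
  have hpsd (w : Fin 4 → ℝ) := sum_sum_mul_gram_nonneg u w
  obtain ⟨v, hv, hker⟩ := exists_sum_sum_mul_gram_eq_zero (by norm_num) u
  have h01 := hm 0 1 (by decide)
  have h02 := hm 0 2 (by decide)
  have h03 := hm 0 3 (by decide)
  have h12 := hm 1 2 (by decide)
  have h13 := hm 1 3 (by decide)
  have h23 := hm 2 3 (by decide)
  simp only [Fin.sum_univ_four, hu, hsymm 1 0, hsymm 2 0, hsymm 3 0, hsymm 2 1, hsymm 3 1,
    hsymm 3 2] at hpsd hv hker
  generalize ∑ k, u 0 k * u 1 k = m01 at *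
  generalize ∑ k, u 0 k * u 2 k = m02 at *
  generalize ∑ k, u 0 k * u 3 k = m03 at *
  generalize ∑ k, u 1 k * u 2 k = m12 at *
  generalize ∑ k, u 1 k * u 3 k = m13 at *
  generalize ∑ k, u 2 k * u 3 k = m23 at *
  have hq (x y z t : ℝ) : 0 ≤ c * (x ^ 2 + y ^ 2 + z ^ 2 + t ^ 2) + 2 * (x * y * m01 + x * z * m02
      + x * t * m03 + y * z * m12 + y * t * m13 + z * t * m23) := by
    refine (hpsd ![x, y, z, t]).trans_eq ?_
    simp only [Matrix.cons_val]
    ring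
  -- On a triangle with inner products 3, 3, -1 this vector gives 17c/4 - 20 < 0. Hence having inner
  -- product 3 is a transitive relation.
  have p1 := hq 1 (-3 / 2) 1 0
  have p2 := hq 1 1 (-3 / 2) 0
  have p3 := hq (-3 / 2) 1 1 0
  have p4 := hq 1 (-3 / 2) 0 1
  have p5 := hq 1 1 0 (-3 / 2)
  have p6 := hq (-3 / 2) 1 0 1
  have p7 := hq 1 0 (-3 / 2) 1
  have p8 := hq 1 0 1 (-3 / 2)
  have p9 := hq (-3 / 2) 0 1 1
  have p10 := hq 0 1 (-3 / 2) 1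
  have p11 := hq 0 1 1 (-3 / 2)
  have p12 := hq 0 (-3 / 2) 1 1
  have hge : 3 ≤ c := by
    have s0 := hq 1 1 1 1
    have s1 := hq 1 (-1) 0 0
    have s2 := hq 1 0 (-1) 0
    have s3 := hq 1 0 0 (-1)
    have s4 := hq 0 1 (-1) 0
    have s5 := hq 0 1 0 (-1)
    have s6 := hq 0 0 1 (-1)
    clear p1 p2 p3 p4 p5 p6 p7 p8 p9 p10 p11 p12
    rcases h01 with h01 | h01
    · rcases h02 with h02 | h02
      · rcases h03 with h03 | h03
        · rcases h12 with h12 | h12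
          · rcases h13 with h13 | h13
            · rcases h23 with h23 | h23
              all_goals linarith
            · linarith
          · linarith
        · linarith
      · linarith
    · linarith
  by_contra hne
  -- At c = 3 the form is 4 ∑ s² - (∑ s)², with s running over the sums of `v` on the at most four
  -- classes; it is nonnegative by Cauchy–Schwarz. For c > 3 the extra (c - 3)|v|² contradicts
  -- vanishing at `v`.
  have hpos := mul_pos (sub_pos.2 (lt_of_le_of_ne hge (Ne.symm hne))) hv
  rcases h01 with rfl | rfl <;> rcases h02 with rfl | rfl <;> rcases h12 with rfl | rfl <;>
    first
    | linarith only [hc, p1, p2, p3]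
    | (rcases h03 with rfl | rfl <;> rcases h13 with rfl | rfl <;> rcases h23 with rfl | rfl <;>
        first
        | linarith only [hc, p4, p5, p6, p7, p8, p9, p10, p11, p12]
        | linarith only [hpos, hker, sq_nonneg (v 0), sq_nonneg (v 1), sq_nonneg (v 2),
            sq_nonneg (v 3), sq_nonneg (v 0 - v 1), sq_nonneg (v 0 - v 2), sq_nonneg (v 0 - v 3),
            sq_nonneg (v 1 - v 2), sq_nonneg (v 1 - v 3), sq_nonneg (v 2 - v 3),
            sq_nonneg (v 0 + v 1), sq_nonneg (v 0 + v 2), sq_nonneg (v 0 + v 3),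
            sq_nonneg (v 1 + v 2), sq_nonneg (v 1 + v 3), sq_nonneg (v 2 + v 3),
            sq_nonneg (v 0 + v 1 + v 2 + v 3), sq_nonneg (v 0 + v 1 - v 2 - v 3),
            sq_nonneg (v 0 - v 1 + v 2 - v 3), sq_nonneg (v 0 - v 1 - v 2 + v 3),
            sq_nonneg (v 0 + v 1 + v 2), sq_nonneg (v 0 + v 1 + v 3), sq_nonneg (v 0 + v 2 + v 3),
            sq_nonneg (v 1 + v 2 + v 3), sq_nonneg (v 0 + v 1 + v 2 - v 3),
            sq_nonneg (v 0 + v 1 + v 3 - v 2), sq_nonneg (v 0 + v 2 + v 3 - v 1),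
            sq_nonneg (v 1 + v 2 + v 3 - v 0), sq_nonneg (v 0 + v 1 - v 2),
            sq_nonneg (v 0 + v 1 - v 3), sq_nonneg (v 0 + v 2 - v 1), sq_nonneg (v 0 + v 2 - v 3),
            sq_nonneg (v 0 + v 3 - v 1), sq_nonneg (v 0 + v 3 - v 2), sq_nonneg (v 1 + v 2 - v 0),
            sq_nonneg (v 1 + v 2 - v 3), sq_nonneg (v 1 + v 3 - v 0), sq_nonneg (v 1 + v 3 - v 2),
            sq_nonneg (v 2 + v 3 - v 0), sq_nonneg (v 2 + v 3 - v 1)])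

/-- Four vectors of the space with the same squared length `c ≤ 4` whose inner products are odd
integers, any three of them around a triangle summing to `1` modulo `4`, have `c = 3`. -/
theorem sq_norm_eq_three_of_gram {c : ℝ} (hc : c ≤ 4) (u : Fin 4 → Fin 3 → ℝ)
    (hu : ∀ i, ∑ k, u i k * u i k = c) (m : Fin 4 → Fin 4 → ℤ)
    (hm : ∀ i j, i ≠ j → ∑ k, u i k * u j k = m i j) (hodd : ∀ i j, i ≠ j → 2 ∣ m i j + 1)
    (h4 : ∀ i j k, i ≠ j → j ≠ k → i ≠ k → 4 ∣ m i j + m j k + m i k - 1) : c = 3 := by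
  have hsymm (i j) (hij : i ≠ j) : m i j = m j i := by
    have h1 := hm i j hij
    have h2 := hm j i hij.symm
    simp only [mul_comm (u j _)] at h2
    exact_mod_cast h1.symm.trans h2
  have hle (i j) (hij : i ≠ j) : -5 < m i j ∧ m i j < 5 := by
    have e1 : ∑ k, (u i k + u j k) ^ 2 = 2 * c + 2 * m i j := by
      rw [← hm i j hij, two_mul c]
      nth_rewrite 1 [← hu i]
      rw [← hu j, Finset.mul_sum, ← Finset.sum_add_distrib, ← Finset.sum_add_distrib]
      exact Finset.sum_congr rfl fun k _ => by ring
    have e2 : ∑ k, (u i k - u j k) ^ 2 = 2 * c - 2 * m i j := by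
      rw [← hm i j hij, two_mul c]
      nth_rewrite 1 [← hu i]
      rw [← hu j, Finset.mul_sum, ← Finset.sum_add_distrib, ← Finset.sum_sub_distrib]
      exact Finset.sum_congr rfl fun k _ => by ring
    have p1 : 0 ≤ ∑ k, (u i k + u j k) ^ 2 := Finset.sum_nonneg fun _ _ => sq_nonneg _
    have p2 : 0 ≤ ∑ k, (u i k - u j k) ^ 2 := Finset.sum_nonneg fun _ _ => sq_nonneg _
    have q1 : (-5 : ℝ) < m i j := by linarith
    have q2 : (m i j : ℝ) < 5 := by linarith
    exact ⟨by exact_mod_cast q1, by exact_mod_cast q2⟩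
  -- Signs making every product with vector 0 congruent to 3 mod 4; the triangle congruence extends
  -- this to all pairs. Between -5 and 5 only -1 and 3 remain.
  let x : Fin 4 → ℤ := fun i => if i = 0 then 1 else if m 0 i % 4 = 3 then 1 else -1
  have hx (i) : x i = 1 ∨ x i = -1 := by
    simp only [x]; split_ifs <;> simp
  have hprod (i j) (hij : i ≠ j) : x i * x j * m i j = -1 ∨ x i * x j * m i j = 3 := by
    have b := hle i j hij
    have o := hodd i j hij
    by_cases hi : i = 0
    · subst hi
      simp only [x, if_neg hij.symm]
      split_ifs <;> omega
    · by_cases hj : j = 0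
      · subst hj
        have s := hsymm 0 i (Ne.symm hi)
        simp only [x, if_neg hi]
        split_ifs <;> omega
      · have t := h4 0 i j (Ne.symm hi) hij (Ne.symm hj)
        have o1 := hodd 0 i (Ne.symm hi)
        have o2 := hodd 0 j (Ne.symm hj)
        simp only [x, if_neg hi, if_neg hj]
        split_ifs <;> omega
  refine sq_norm_eq_three_of_gram_mem hc (fun i k => x i * u i k) (fun i => ?_)
    fun i j hij => ?_
  · rw [← hu i]
    refine Finset.sum_congr rfl fun k _ => ?_
    rcases hx i with h | h <;> simp only [h] <;> push_cast <;> ring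
  · have h : ∑ k, (x i * u i k) * (x j * u j k) = ((x i * x j * m i j : ℤ) : ℝ) := by
      push_cast
      rw [← hm i j hij, Finset.mul_sum]
      exact Finset.sum_congr rfl fun k _ => by ring
    rw [h]
    rcases hprod i j hij with h | h <;> rw [h] <;> norm_num

/-! ### Skew blocks of order at most three -/

open Polynomial in
theorem charpoly_fin_one_of_skew {D : Matrix (Fin 1) (Fin 1) ℝ} (hD : D.transpose = -D) :
    D.charpoly = X := by
  have h : D = 0 := by
    ext i j
    have := congrFun (congrFun hD 0) 0
    simp only [Matrix.transpose_apply, Matrix.neg_apply] at this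
    rw [Subsingleton.elim i 0, Subsingleton.elim j 0, Matrix.zero_apply]
    linarith
  rw [h, Matrix.charpoly_zero]; simp

open Polynomial in
theorem charpoly_fin_two_of_skew {D : Matrix (Fin 2) (Fin 2) ℝ} (hD : D.transpose = -D) :
    D.charpoly = X ^ 2 + C (-(D * D).trace / 2) := by
  have h (i j) : D i j = -D j i := by simpa using congrFun (congrFun hD j) i
  have h00 : D 0 0 = 0 := by linarith [h 0 0]
  have h11 : D 1 1 = 0 := by linarith [h 1 1]
  refine Polynomial.funext fun x => ?_
  rw [Matrix.eval_charpoly, Matrix.det_fin_two]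
  simp [Matrix.trace, Matrix.mul_apply, Fin.sum_univ_two, h00, h11, h 1 0]
  ring

open Polynomial in
theorem charpoly_fin_three_of_skew {D : Matrix (Fin 3) (Fin 3) ℝ} (hD : D.transpose = -D) :
    D.charpoly = X * (X ^ 2 + C (-(D * D).trace / 2)) := by
  have h (i j) : D i j = -D j i := by simpa using congrFun (congrFun hD j) i
  have h00 : D 0 0 = 0 := by linarith [h 0 0]
  have h11 : D 1 1 = 0 := by linarith [h 1 1]
  have h22 : D 2 2 = 0 := by linarith [h 2 2]
  refine Polynomial.funext fun x => ?_
  rw [Matrix.eval_charpoly, Matrix.det_fin_three]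
  simp [Matrix.trace, Matrix.mul_apply, Fin.sum_univ_three, h00, h11, h22, h 1 0, h 2 0, h 2 1]
  ring

/-- Turns the trace identity for an extension into an upper bound on c. -/
theorem trace_mul_self_nonpos_of_skew {m : Type*} [Fintype m] {D : Matrix m m ℝ}
    (hD : D.transpose = -D) : (D * D).trace ≤ 0 := by
  have h (i j) : D i j = -D j i := by simpa using congrFun (congrFun hD j) i
  rw [Matrix.trace]
  refine Finset.sum_nonpos fun i _ => ?_
  rw [Matrix.diag_apply, Matrix.mul_apply]
  exact Finset.sum_nonpos fun j _ => by rw [h j i]; nlinarith [sq_nonneg (D i j)]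

/-! ### Gram data of an extension; no or one new row -/

/-- The data of a quasi-orthogonal extension of a tournament by `d` rows: the Gram matrix of the
rows of the off-diagonal block `B` has constant diagonal `c` and integer off-diagonal entries `m`
satisfying congruences. -/
theorem Digraph.IsTournament.exists_gram_of_mem_defects {V : Type*} [Fintype V] [DecidableEq V]
    {T : Digraph V} (hT : T.IsTournament) {n d : ℕ} (hV : Fintype.card V = n)
    (h : d ∈ quasiOrthogonalityDefects T.skewAdjMatrix) :
    ∃ (c : ℝ) (B : Matrix V (Fin d) ℝ) (D : Matrix (Fin d) (Fin d) ℝ) (m : V → V → ℤ),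
      0 < c + (n - 1) ∧ D.transpose = -D ∧
      n * c = d * (c + (n - 1)) + (D * D).trace ∧
      (∀ a, n = 2 * a + d → T.skewCharpoly =
        (Polynomial.X ^ 2 + Polynomial.C (c + (n - 1))) ^ a * D.charpoly) ∧
      (∀ i, ∑ k, B i k * B i k = c) ∧ (∀ i j, i ≠ j → ∑ k, B i k * B j k = m i j) ∧
      (∀ i j, i ≠ j → 2 ∣ m i j + n) ∧
      ∀ i j k, i ≠ j → j ≠ k → i ≠ k → 4 ∣ m i j + m j k + m i k - n := by
  have hS := hT.skewAdjMatrix_transpose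
  obtain ⟨q, B, D, hq, hD, h11, h22, h12⟩ := exists_blocks_of_mem_defects hS h
  obtain ⟨Z, hSZ, h0, h1, hs⟩ := hT.exists_int_skewAdjMatrix
  have hBB (i j) : ∑ k, B i k * B j k =
      (if i = j then q else 0) - ((∑ l, Z l i * Z l j : ℤ) : ℝ) := by
    have e1 := congrFun (congrFun h11 i) j
    have e2 : (T.skewAdjMatrix * T.skewAdjMatrix) i j = -((∑ l, Z l i * Z l j : ℤ) : ℝ) := by
      rw [Matrix.mul_apply]
      push_cast
      rw [← Finset.sum_neg_distrib]
      refine Finset.sum_congr rfl fun l _ => ?_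
      rw [hSZ, hSZ, hs l i]; push_cast; ring
    rw [Matrix.sub_apply, e2, Matrix.mul_apply, Matrix.smul_apply, Matrix.one_apply] at e1
    simp only [Matrix.transpose_apply, smul_eq_mul, mul_ite, mul_one, mul_zero] at e1
    linarith
  have hdiag (i) : ∑ k, B i k * B i k = q - (n - 1) := by
    rw [hBB, gram_self h0 h1, hV]; simp
  refine ⟨q - (n - 1), B, D, fun i j => -∑ l, Z l i * Z l j, by linarith, hD, ?_, ?_, hdiag, ?_,
    ?_, ?_⟩
  · have t1 : (B * B.transpose).trace = n * (q - (n - 1)) := by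
      simp only [Matrix.trace, Matrix.diag_apply, Matrix.mul_apply, Matrix.transpose_apply, hdiag]
      simp only [Finset.sum_const, Finset.card_univ, hV, nsmul_eq_mul]
    have t2 := congrArg Matrix.trace h22
    rw [Matrix.trace_sub, Matrix.trace_mul_comm, t1, Matrix.trace_smul, Matrix.trace_one,
      Fintype.card_fin, smul_eq_mul] at t2
    linarith
  · intro a ha
    rw [sub_add_cancel]
    exact charpoly_eq_of_blocks hS hD h11 h22 h12 (by rw [hV, Fintype.card_fin, ha])
  · intro i j hij
    rw [hBB, if_neg hij]; simp
  · intro i j hij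
    show 2 ∣ -∑ l, Z l i * Z l j + (n : ℤ)
    have := two_dvd_gram_add_card h0 h1 hij
    rw [hV] at this
    omega
  · intro i j k hij hjk hik
    show 4 ∣ -∑ l, Z l i * Z l j + -∑ l, Z l j * Z l k + -∑ l, Z l i * Z l k - (n : ℤ)
    have := four_dvd_gram_add_gram_add_gram_add_card h0 h1 hs hij hjk hik
    rw [hV] at this
    omega

theorem exists_fin_injective {V : Type*} [Fintype V] {r : ℕ} (h : r ≤ Fintype.card V) :
    ∃ f : Fin r → V, Function.Injective f :=
  ⟨fun i => (Fintype.equivFin V).symm (Fin.castLE h i),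
    (Fintype.equivFin V).symm.injective.comp (Fin.castLE_injective h)⟩

/-- All inner products are empty sums, so the triangle congruence reads 4 ∣ -n. -/
theorem Digraph.IsTournament.four_dvd_of_zero_mem_defects {V : Type*} [Fintype V] [DecidableEq V]
    {T : Digraph V} (hT : T.IsTournament) (hV : 3 ≤ Fintype.card V)
    (h : 0 ∈ quasiOrthogonalityDefects T.skewAdjMatrix) : 4 ∣ Fintype.card V := by
  obtain ⟨c, B, D, m, -, -, -, -, -, hm, -, h4⟩ := hT.exists_gram_of_mem_defects rfl h
  obtain ⟨f, hf⟩ := exists_fin_injective hV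
  have e (i j) (hij : i ≠ j) : m i j = 0 := by
    have := hm i j hij
    simp only [Finset.univ_eq_empty, Finset.sum_empty] at this
    exact_mod_cast this.symm
  have h01 : f 0 ≠ f 1 := hf.ne (by decide)
  have h12 : f 1 ≠ f 2 := hf.ne (by decide)
  have h02 : f 0 ≠ f 2 := hf.ne (by decide)
  have := h4 _ _ _ h01 h12 h02
  rw [e _ _ h01, e _ _ h12, e _ _ h02] at this
  omega

theorem trace_mul_self_fin_one_of_skew {D : Matrix (Fin 1) (Fin 1) ℝ} (hD : D.transpose = -D) :
    (D * D).trace = 0 := by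
  have := congrFun (congrFun hD 0) 0
  simp only [Matrix.transpose_apply, Matrix.neg_apply] at this
  have h0 : D 0 0 = 0 := by linarith
  simp [Matrix.trace, Matrix.mul_apply, h0]

/-- The trace identity for d = 1, where `D = 0`; `(1 : ℕ)` is the cast of d. -/
theorem eq_one_of_mul_eq_add {n : ℕ} (hn : 2 ≤ n) {c t : ℝ}
    (ht : (n : ℝ) * c = (1 : ℕ) * (c + (n - 1)) + t) (h0 : t = 0) : c = 1 := by
  have h : ((n : ℝ) - 1) * (c - 1) = 0 := by
    rw [h0] at ht; push_cast at ht; linarith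
  have hn' : (2 : ℝ) ≤ n := by exact_mod_cast hn
  rcases mul_eq_zero.1 h with h | h <;> linarith

/-- Here `B` is a column of signs, and the pairwise products of three signs sum to 3 or -1, both 3
mod 4. -/
theorem Digraph.IsTournament.four_dvd_add_one_of_one_mem_defects {V : Type*} [Fintype V]
    [DecidableEq V] {T : Digraph V} (hT : T.IsTournament) (hV : 3 ≤ Fintype.card V)
    (h : 1 ∈ quasiOrthogonalityDefects T.skewAdjMatrix) : 4 ∣ Fintype.card V + 1 := by
  obtain ⟨c, B, D, m, -, hD, ht, -, hc, hm, hp, h4⟩ := hT.exists_gram_of_mem_defects rfl h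
  have hc1 := eq_one_of_mul_eq_add (by omega) ht (trace_mul_self_fin_one_of_skew hD)
  obtain ⟨f, hf⟩ := exists_fin_injective hV
  have h01 : f 0 ≠ f 1 := hf.ne (by decide)
  have h12 : f 1 ≠ f 2 := hf.ne (by decide)
  have h02 : f 0 ≠ f 2 := hf.ne (by decide)
  have hB (i) : B i 0 = 1 ∨ B i 0 = -1 := by
    have := hc i
    rw [hc1] at this
    simpa [mul_self_eq_one_iff] using this
  have hd := h4 _ _ _ h01 h12 h02
  have m1 := hm _ _ h01
  have m2 := hm _ _ h12
  have m3 := hm _ _ h02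
  simp only [Finset.univ_unique, Fin.default_eq_zero, Finset.sum_singleton] at m1 m2 m3
  rcases hB (f 0) with e0 | e0 <;> rcases hB (f 1) with e1 | e1 <;>
    rcases hB (f 2) with e2 | e2 <;> rw [e0, e1] at m1 <;> rw [e1, e2] at m2 <;>
    rw [e0, e2] at m3 <;> norm_num at m1 m2 m3 <;> norm_cast at m1 m2 m3 <;> omega

theorem Digraph.IsTournament.le_tournamentIndex {V : Type*} [Fintype V] [DecidableEq V]
    {T : Digraph V} (hT : T.IsTournament) {r : ℕ}
    (h : ∀ d ∈ quasiOrthogonalityDefects T.skewAdjMatrix, r ≤ d) :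
    r ≤ T.tournamentIndex ∧
      (T.tournamentIndex = r ↔ r ∈ quasiOrthogonalityDefects T.skewAdjMatrix) := by
  have hl := isLeast_quasiOrthogonalityIndex _ hT.skewAdjMatrix_transpose
  refine ⟨h _ hl.1, fun e => e ▸ hl.1, fun hr => le_antisymm (hl.2 hr) (h _ hl.1)⟩

/-! ### Polynomials characterising the minimal extensions -/

section

open Polynomial

variable {V : Type*} [Fintype V] [DecidableEq V] {T : Digraph V}

theorem Digraph.IsTournament.zero_mem_defects_iff (hT : T.IsTournament) {k : ℕ}
    (hV : Fintype.card V = 4 * k + 4) :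
    0 ∈ quasiOrthogonalityDefects T.skewAdjMatrix ↔
      T.skewCharpoly = (X ^ 2 + C (4 * (k : ℝ) + 3)) ^ (2 * k + 2) := by
  constructor
  · intro h
    obtain ⟨c, B, D, m, -, hD, ht, hχ, -⟩ := hT.exists_gram_of_mem_defects hV h
    have hc : c = 0 := by
      have : ((4 * k + 4 : ℕ) : ℝ) * c = 0 := by rw [ht]; simp [Matrix.trace]
      exact (mul_eq_zero.1 this).resolve_left (by positivity)
    rw [hχ (2 * k + 2) (by omega), Matrix.charpoly_isEmpty, mul_one, hc]
    congr 3
    push_cast; ring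
  · intro h
    refine mem_defects_of_charpoly_sq hT.skewAdjMatrix_transpose (q := 4 * k + 3) (by positivity)
      (R := 1) (by simp) (m := 4 * k + 4) (by omega) ?_
    rw [← Digraph.skewCharpoly, h]
    simp only [map_mul, map_pow, map_add, expand_X, expand_C, map_one]
    ring

theorem Digraph.IsTournament.one_mem_defects_iff (hT : T.IsTournament) {k : ℕ}
    (hV : Fintype.card V = 4 * k + 3) :
    1 ∈ quasiOrthogonalityDefects T.skewAdjMatrix ↔
      T.skewCharpoly = X * (X ^ 2 + C (4 * (k : ℝ) + 3)) ^ (2 * k + 1) := by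
  constructor
  · intro h
    obtain ⟨c, B, D, m, -, hD, ht, hχ, -⟩ := hT.exists_gram_of_mem_defects hV h
    have hc := eq_one_of_mul_eq_add (by omega) ht (trace_mul_self_fin_one_of_skew hD)
    rw [hχ (2 * k + 1) (by omega), charpoly_fin_one_of_skew hD, hc, mul_comm]
    congr 4
    push_cast; ring
  · intro h
    refine mem_defects_of_charpoly_sq hT.skewAdjMatrix_transpose (q := 4 * k + 3) (by positivity)
      (R := X) (fun r hr => ?_) (m := 4 * k + 2) (by omega) ?_
    · rw [eval_X] at hr
      rw [hr]
      exact neg_lt_zero.2 (by positivity)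
    · rw [← Digraph.skewCharpoly, h]
      simp only [map_mul, map_pow, map_add, expand_X, expand_C]
      ring

theorem Digraph.IsTournament.two_mem_defects_iff (hT : T.IsTournament) {k : ℕ} (hk : 1 ≤ k)
    (hV : Fintype.card V = 4 * k + 2) :
    2 ∈ quasiOrthogonalityDefects T.skewAdjMatrix ↔
      T.skewCharpoly = (X ^ 2 + C (4 * (k : ℝ) + 3)) ^ (2 * k) * (X ^ 2 + 1) := by
  have hk' : (1 : ℝ) ≤ k := by exact_mod_cast hk
  constructor
  · intro h
    obtain ⟨c, B, D, m, hq, hD, ht, hχ, hc, hm, h2, h4⟩ := hT.exists_gram_of_mem_defects hV h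
    have htr := trace_mul_self_nonpos_of_skew hD
    push_cast at ht
    have hc2 : c = 2 := by
      obtain ⟨f, hf⟩ := exists_fin_injective (V := V) (r := 3) (by omega)
      have h01 : f 0 ≠ f 1 := hf.ne (by decide)
      have h12 : f 1 ≠ f 2 := hf.ne (by decide)
      have h02 : f 0 ≠ f 2 := hf.ne (by decide)
      have d01 := h2 _ _ h01
      have d12 := h2 _ _ h12
      have d02 := h2 _ _ h02
      have d4 := h4 _ _ _ h01 h12 h02
      -- The trace identity gives 4k c ≤ 8k + 2, so c ≤ 5/2 as k ≥ 1.
      refine sq_norm_eq_two_of_gram (by nlinarith) (fun i => B (f i)) (fun i => hc (f i))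
        (hm _ _ h01) (hm _ _ h02) (hm _ _ h12) ?_ ?_ ?_ ?_ <;> omega
    subst hc2
    have htr' : (D * D).trace = -2 := by linarith
    rw [hχ (2 * k) (by omega), charpoly_fin_two_of_skew hD, htr']
    have e1 : (2 : ℝ) + (((4 * k + 2 : ℕ) : ℝ) - 1) = 4 * k + 3 := by push_cast; ring
    rw [e1]
    norm_num
  · intro h
    -- `R` is the part of the characteristic polynomial of `S * S` away from -q; its only root is
    -- -1.
    refine mem_defects_of_charpoly_sq hT.skewAdjMatrix_transpose (q := 4 * k + 3) (by positivity)
      (R := (X + 1) ^ 2) (fun r hr => ?_) (m := 4 * k) (by omega) ?_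
    · have : r + 1 = 0 := by simpa using hr
      linarith
    · rw [← Digraph.skewCharpoly, h]
      simp only [map_mul, map_pow, map_add, expand_X, expand_C, map_one]
      ring

theorem Digraph.IsTournament.three_mem_defects_iff (hT : T.IsTournament) {k : ℕ} (hk : 2 ≤ k)
    (hV : Fintype.card V = 4 * k + 1) :
    3 ∈ quasiOrthogonalityDefects T.skewAdjMatrix ↔
      T.skewCharpoly = X * (X ^ 2 + C (4 * (k : ℝ) + 3)) ^ (2 * k - 1) * (X ^ 2 + C 3) := by
  have hk' : (2 : ℝ) ≤ k := by exact_mod_cast hk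
  constructor
  · intro h
    obtain ⟨c, B, D, m, hq, hD, ht, hχ, hc, hm, h2, h4⟩ := hT.exists_gram_of_mem_defects hV h
    have htr := trace_mul_self_nonpos_of_skew hD
    push_cast at ht
    have hc3 : c = 3 := by
      obtain ⟨f, hf⟩ := exists_fin_injective (V := V) (r := 4) (by omega)
      -- The trace identity gives (4k - 2) c ≤ 12k. This yields c ≤ 4 exactly when k ≥ 2, which is
      -- why order 5 stands apart.
      refine sq_norm_eq_three_of_gram (by nlinarith) (fun i => B (f i)) (fun i => hc (f i))
        (fun i j => m (f i) (f j)) (fun i j hij => hm _ _ (hf.ne hij)) (fun i j hij => ?_)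
        fun i j l hij hjl hil => ?_
      · have := h2 _ _ (hf.ne hij)
        omega
      · have := h4 _ _ _ (hf.ne hij) (hf.ne hjl) (hf.ne hil)
        omega
    subst hc3
    have htr' : (D * D).trace = -6 := by linarith
    rw [hχ (2 * k - 1) (by omega), charpoly_fin_three_of_skew hD, htr']
    have e1 : (3 : ℝ) + (((4 * k + 1 : ℕ) : ℝ) - 1) = 4 * k + 3 := by push_cast; ring
    rw [e1, show (-(-6) / 2 : ℝ) = 3 by norm_num]
    ring
  · intro h
    refine mem_defects_of_charpoly_sq hT.skewAdjMatrix_transpose (q := 4 * k + 3) (by positivity)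
      (R := X * (X + C 3) ^ 2) (fun r hr => ?_) (m := 2 * (2 * k - 1)) (by omega) ?_
    · have : r = 0 ∨ r + 3 = 0 := by simpa using hr
      rcases this with h | h <;> linarith
    · rw [← Digraph.skewCharpoly, h]
      simp only [map_mul, map_pow, map_add, expand_X, expand_C]
      ring

end

/-! ### The four residue classes -/

open Polynomial in
theorem theorem5 {V : Type*} [Fintype V] [DecidableEq V] (T : Digraph V) (hT : T.IsTournament)
    (n : ℕ) (hV : Fintype.card V = n) (hn : 4 ≤ n) :
    (∀ k : ℕ, n = 4 * k + 4 →
      0 ≤ T.tournamentIndex ∧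
      (T.tournamentIndex = 0 ↔
        T.skewCharpoly = (X ^ 2 + C (4 * (k : ℝ) + 3)) ^ (2 * k + 2))) ∧
    (∀ k : ℕ, n = 4 * k + 3 →
      1 ≤ T.tournamentIndex ∧
      (T.tournamentIndex = 1 ↔
        T.skewCharpoly = X * (X ^ 2 + C (4 * (k : ℝ) + 3)) ^ (2 * k + 1))) ∧
    (∀ k : ℕ, n = 4 * k + 2 →
      2 ≤ T.tournamentIndex ∧
      (T.tournamentIndex = 2 ↔
        T.skewCharpoly = (X ^ 2 + C (4 * (k : ℝ) + 3)) ^ (2 * k) * (X ^ 2 + 1))) ∧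
    (∀ k : ℕ, n = 4 * k + 1 →
      3 ≤ T.tournamentIndex ∧
      (T.tournamentIndex = 3 ↔
        n = 5 ∨ (9 ≤ n ∧
          T.skewCharpoly =
            X * (X ^ 2 + C (4 * (k : ℝ) + 3)) ^ (2 * k - 1) * (X ^ 2 + C 3)))) := by
  have heven (d) (hd : d ∈ quasiOrthogonalityDefects T.skewAdjMatrix) : 2 ∣ n + d :=
    hV ▸ (even_card_add_of_mem_defects hd).two_dvd
  have hzero (h : 0 ∈ quasiOrthogonalityDefects T.skewAdjMatrix) : 4 ∣ n :=
    hV ▸ hT.four_dvd_of_zero_mem_defects (by omega) h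
  have hone (h : 1 ∈ quasiOrthogonalityDefects T.skewAdjMatrix) : 4 ∣ n + 1 :=
    hV ▸ hT.four_dvd_add_one_of_one_mem_defects (by omega) h
  have hlow (r : ℕ) (hr : (r ≤ 3 ∧ 4 ∣ n + r)) :
      ∀ d ∈ quasiOrthogonalityDefects T.skewAdjMatrix, r ≤ d := by
    intro d hd
    have h2 := heven d hd
    by_contra! hlt
    -- A defect 0 or 1 would force r = 0 or r = 1 modulo 4; a defect 2 below r = 3 has the wrong
    -- parity.
    obtain rfl | rfl | rfl : d = 0 ∨ d = 1 ∨ d = 2 := by omega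
    · have := hzero hd; omega
    · have := hone hd; omega
    · omega
  refine ⟨fun k hk => ?_, fun k hk => ?_, fun k hk => ?_, fun k hk => ?_⟩
  · rw [← hT.zero_mem_defects_iff (hV.trans hk)]
    exact hT.le_tournamentIndex (hlow 0 (by omega))
  · rw [← hT.one_mem_defects_iff (hV.trans hk)]
    exact hT.le_tournamentIndex (hlow 1 (by omega))
  · rw [← hT.two_mem_defects_iff (by omega) (hV.trans hk)]
    exact hT.le_tournamentIndex (hlow 2 (by omega))
  · have h3 := hlow 3 (by omega)
    refine ⟨(hT.le_tournamentIndex h3).1, (hT.le_tournamentIndex h3).2.trans ?_⟩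
    by_cases h5 : n = 5
    · refine iff_of_true ?_ (Or.inl h5)
      -- Order 5 gives a defect d ≤ 5 - 2, and d ≥ 3 is already known.
      obtain ⟨d, hd, hle⟩ := exists_mem_defects_add_two_le hT.skewAdjMatrix_transpose (by
        intro h
        obtain ⟨u, v, huv⟩ := Fintype.one_lt_card_iff.1 (show 1 < Fintype.card V by omega)
        obtain ⟨Z, hZ, -, h1, -⟩ := hT.exists_int_skewAdjMatrix
        have e := hZ u v
        rw [h, Matrix.zero_apply] at e
        rcases h1 u v huv with e1 | e1 <;> rw [e1] at e <;> norm_num at e)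
      have := h3 d hd
      obtain rfl : d = 3 := by omega
      exact hd
    · rw [hT.three_mem_defects_iff (by omega) (hV.trans hk)]
      constructor
      · exact fun h => Or.inr ⟨by omega, h⟩
      · rintro (h | h)
        · exact absurd h h5
        · exact h.2
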